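/- Let $\pi$ be a set of primes, let $R=\prod_{p\in\pi}\mathbb{Z}_p$ with the product topology (where $\mathbb{Z}_p$ is the ring of $p$-adic integers), and let $\mathrm{UT}_3(R)$ be the Heisenberg group over $R$, i.e. the profinite group of upper unitriangular $3\times 3$ matrices over $R$. A profinite group $G$ is called finitely axiomatizable (FA) within a class $\mathcal{C}$ of profinite groups if there is a first-order sentence $\theta$ in the language of groups such that $G\models\theta$ and every $H\in\mathcal{C}$ with $H\models\theta$ is isomorphic to $G$ as a topological group. If $\mathrm{UT}_3(R)$ is FA within the class of all profinite groups, then $\pi$ is finite. Likewise, if $\mathrm{UT}_3(R)$ is FA within the class of separable (that is, second countable) profinite groups, then $\pi$ is finite. -/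

import Mathlib

namespace HeisenbergFA

open FirstOrder

/-- Function symbols of the language of groups: multiplication, inversion, identity. -/
inductive GroupFunc : ℕ → Type
  | mul : GroupFunc 2
  | inv : GroupFunc 1
  | one : GroupFunc 0

/-- The first-order language of groups (no relation symbols besides equality). -/
def groupLang : FirstOrder.Language.{0, 0} where
  Functions := GroupFunc
  Relations := fun _ => Empty

/-- Every group, viewed as a structure in the language of groups. -/
instance groupStructure (G : Type*) [Group G] : groupLang.Structure G where
  funMap := fun {_} f => match f with
    | .mul => fun x => x 0 * x 1
    | .inv => fun x => (x 0)⁻¹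
    | .one => fun _ => 1
  RelMap := fun {_} r => Empty.elim r

/-- The Heisenberg group `UT₃(R)`: the group of upper unitriangular `3 × 3` matrices over `R`,
with the topology induced by that of the matrices when `R` is a topological ring. -/
def UT3 (R : Type*) [CommRing R] : Subgroup (Matrix.SpecialLinearGroup (Fin 3) R) where
  carrier := {A | (∀ i, A i i = 1) ∧ ∀ i j, j < i → A i j = 0}
  one_mem' := by
    refine ⟨fun i => by simp, fun i j h => ?_⟩
    simp [Matrix.one_apply_ne h.ne']
  mul_mem' := by
    rintro A B ⟨hA, hA'⟩ ⟨hB, hB'⟩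
    have a10 := hA' 1 0 (by decide)
    have a20 := hA' 2 0 (by decide)
    have a21 := hA' 2 1 (by decide)
    have b10 := hB' 1 0 (by decide)
    have b20 := hB' 2 0 (by decide)
    have b21 := hB' 2 1 (by decide)
    constructor
    · intro i
      fin_cases i <;> simp [Matrix.mul_apply, Fin.sum_univ_three, *]
    · intro i j h
      fin_cases i <;> fin_cases j <;>
        first
        | exact absurd h (by decide)
        | simp [Matrix.mul_apply, Fin.sum_univ_three, *]
  inv_mem' := by
    rintro A ⟨hA, hA'⟩
    have a10 := hA' 1 0 (by decide)
    have a20 := hA' 2 0 (by decide)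
    have a21 := hA' 2 1 (by decide)
    constructor
    · intro i
      fin_cases i <;> simp [Matrix.adjugate_fin_three, *]
    · intro i j h
      fin_cases i <;> fin_cases j <;>
        first
        | exact absurd h (by decide)
        | simp [Matrix.adjugate_fin_three, *]

section Topology

variable (R : Type*) [CommRing R] [TopologicalSpace R]

theorem isClosed_SL [IsTopologicalRing R] [T2Space R] :
    IsClosed {A : Matrix (Fin 3) (Fin 3) R | A.det = 1} :=
  isClosed_eq (Continuous.matrix_det continuous_id) continuous_const

instance compactSpace_SL [IsTopologicalRing R] [T2Space R] [CompactSpace R] :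
    CompactSpace (Matrix.SpecialLinearGroup (Fin 3) R) :=
  haveI : CompactSpace (Matrix (Fin 3) (Fin 3) R) :=
    inferInstanceAs (CompactSpace (Fin 3 → Fin 3 → R))
  isCompact_iff_compactSpace.mp (isClosed_SL R).isCompact

instance totallyDisconnectedSpace_SL [TotallyDisconnectedSpace R] :
    TotallyDisconnectedSpace (Matrix.SpecialLinearGroup (Fin 3) R) :=
  haveI : TotallyDisconnectedSpace (Matrix (Fin 3) (Fin 3) R) :=
    inferInstanceAs (TotallyDisconnectedSpace (Fin 3 → Fin 3 → R))
  inferInstanceAs (TotallyDisconnectedSpace {A : Matrix (Fin 3) (Fin 3) R // A.det = 1})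

theorem isClosed_UT3 [T2Space R] :
    IsClosed (UT3 R : Set (Matrix.SpecialLinearGroup (Fin 3) R)) := by
  have hc : ∀ i j, Continuous fun A : Matrix.SpecialLinearGroup (Fin 3) R => A i j :=
    fun i j => (continuous_id.matrix_elem i j).comp continuous_subtype_val
  have : (UT3 R : Set (Matrix.SpecialLinearGroup (Fin 3) R)) =
      (⋂ i, {A | A i i = 1}) ∩ ⋂ i, ⋂ j, ⋂ (_ : j < i), {A | A i j = 0} := by
    ext A
    simp [UT3]
  rw [this]
  exact (isClosed_iInter fun i => isClosed_eq (hc i i) continuous_const).inter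
    (isClosed_iInter fun i => isClosed_iInter fun j => isClosed_iInter fun _ =>
      isClosed_eq (hc i j) continuous_const)

instance compactSpace_UT3 [IsTopologicalRing R] [T2Space R] [CompactSpace R] :
    CompactSpace (UT3 R) :=
  isCompact_iff_compactSpace.mp (isClosed_UT3 R).isCompact

/-- The Heisenberg group over a profinite commutative ring, as a profinite group. -/
def profiniteUT3 [IsTopologicalRing R] [CompactSpace R] [T2Space R] [TotallyDisconnectedSpace R] :
    ProfiniteGrp :=
  ProfiniteGrp.of (UT3 R)

end Topology

instance factPrime (p : Nat.Primes) : Fact (p : ℕ).Prime := ⟨p.2⟩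

/-- The profinite ring `∏_{p ∈ π} ℤ_p`, with the product topology. -/
abbrev PadicProd (π : Set Nat.Primes) : Type := ∀ p : π, ℤ_[((p : Nat.Primes) : ℕ)]

/-- The profinite group `G` is finitely axiomatizable within the class `𝒞` of profinite groups:
there is a first-order sentence `θ` in the language of groups that holds in `G` and such that
every group in `𝒞` satisfying `θ` is isomorphic to `G` as a topological group. -/
def IsFAWithin (𝒞 : Set ProfiniteGrp.{0}) (G : ProfiniteGrp.{0}) : Prop :=
  ∃ θ : groupLang.Sentence, G ⊨ θ ∧ ∀ H ∈ 𝒞, H ⊨ θ → Nonempty (H ≃ₜ* G)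

/-- The class of all profinite groups. -/
def allProfinite : Set ProfiniteGrp.{0} := Set.univ

/-- The class of separable (second countable, i.e. countably based) profinite groups. -/
def separableProfinite : Set ProfiniteGrp.{0} := {H | SecondCountableTopology H}

end HeisenbergFA

namespace HeisenbergFA

open FirstOrder

/-! ### First-order sentences in direct products of two groups. -/

section FefermanVaught

/-! Suppose `π` is infinite and `θ` axiomatizes the group. For each `p` in `π` the factor `UT3
ℤ_[p]` splits off (`equivUT3Prod`, `padicProdSplit`). By a Feferman–Vaught argument, the truth of
`θ` in `A × B` depends on `A` only through one of finitely many types, so two primes `q ≠ q'` in `π`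
have interchangeable factors (`exists_ne_realize_prod_iff`). Replace the factor at `q` by a second
copy of the one at `q'`: the result is a second countable profinite group still satisfying `θ`.

The two groups are not isomorphic, even abstractly. The `q`-th power map is onto on a Heisenberg
group exactly when `q` is a unit in the ring (`pow_surjective_of_isUnit`,
`isUnit_of_pow_surjective`). This holds for the new group, where no `ℤ_q` is left, and fails for the
original. A counterexample among separable groups also settles the class of all profinite groups. -/

/-- A group homomorphism is a homomorphism of structures in the language of groups. -/
def homOfMonoidHom {A B : Type*} [Group A] [Group B] (f : A →* B) : A →[groupLang] B where
  toFun := f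
  map_fun' := by
    intro n g x
    cases g
    · exact map_mul f _ _
    · exact map_inv f _
    · exact map_one f
  map_rel' := fun r => Empty.elim r

/-- An isomorphism of groups is an isomorphism of structures in the language of groups. -/
def equivOfMulEquiv {A B : Type*} [Group A] [Group B] (e : A ≃* B) : A ≃[groupLang] B where
  toEquiv := e.toEquiv
  map_fun' := (homOfMonoidHom e.toMonoidHom).map_fun'
  map_rel' := fun r => Empty.elim r

theorem realize_sentence_iff_of_mulEquiv {A B : Type*} [Group A] [Group B] (e : A ≃* B)
    (θ : groupLang.Sentence) : A ⊨ θ ↔ B ⊨ θ :=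
  Language.StrongHomClass.realize_sentence (equivOfMulEquiv e) θ

theorem realize_term_prod {A B : Type*} [Group A] [Group B] {α : Type*} (t : groupLang.Term α)
    (v : α → A × B) :
    t.realize v = (t.realize (fun i => (v i).1), t.realize (fun i => (v i).2)) :=
  Prod.ext
    (Language.HomClass.realize_term (homOfMonoidHom (MonoidHom.fst A B)) (t := t) (v := v)).symm
    (Language.HomClass.realize_term (homOfMonoidHom (MonoidHom.snd A B)) (t := t) (v := v)).symm

/-- Finitely many types of tuples in the first factor decide the truth of a formula in a direct
product of two groups, once the second factor is fixed. -/
theorem exists_finite_type_classification {n : ℕ} (φ : groupLang.BoundedFormula Empty n) :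
    ∃ (T : Type) (_ : Finite T) (τ : ∀ (A : Type) [Group A], (Fin n → A) → T),
      ∀ (A A' B : Type) [Group A] [Group A'] [Group B] (a : Fin n → A) (a' : Fin n → A')
        (b : Fin n → B), τ A a = τ A' a' →
        (φ.Realize (default : Empty → A × B) (fun i => (a i, b i)) ↔
          φ.Realize (default : Empty → A' × B) (fun i => (a' i, b i))) := by
  induction φ with
  | falsum => exact ⟨Unit, inferInstance, fun _ _ _ => (), fun _ _ _ _ _ _ _ _ _ _ => Iff.rfl⟩
  | @equal n t₁ t₂ =>
    -- An equation holds in a product iff it holds in both coordinates, so its truth value in the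
    -- first factor is all that matters.
    refine ⟨Prop, inferInstance, fun A _ a =>
      t₁.realize (Sum.elim (default : Empty → A) a) =
        t₂.realize (Sum.elim (default : Empty → A) a), ?_⟩
    intro A A' B _ _ _ a a' b h
    have key : ∀ (C : Type) [Group C] (c : Fin n → C),
        (Language.BoundedFormula.equal t₁ t₂).Realize (default : Empty → C × B)
          (fun i => (c i, b i)) ↔
        (t₁.realize (Sum.elim (default : Empty → C) c) =
          t₂.realize (Sum.elim (default : Empty → C) c)) ∧
        (t₁.realize (Sum.elim (default : Empty → B) b) =
          t₂.realize (Sum.elim (default : Empty → B) b)) := by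
      intro C _ c
      have h₁ : (fun i => (Sum.elim (default : Empty → C × B) (fun i => (c i, b i)) i).1) =
          Sum.elim (default : Empty → C) c := by
        funext i; rcases i with i | i
        · exact i.elim
        · rfl
      have h₂ : (fun i => (Sum.elim (default : Empty → C × B) (fun i => (c i, b i)) i).2) =
          Sum.elim (default : Empty → B) b := by
        funext i; rcases i with i | i
        · exact i.elim
        · rfl
      rw [Language.BoundedFormula.Realize, realize_term_prod, realize_term_prod t₂, h₁, h₂,
        Prod.mk.injEq]
    dsimp only at h
    rw [key, key, h]
  | rel R => exact Empty.elim R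
  | imp φ ψ ihφ ihψ =>
    obtain ⟨T, _, τ, hτ⟩ := ihφ
    obtain ⟨U, _, σ, hσ⟩ := ihψ
    refine ⟨T × U, inferInstance, fun A _ a => (τ A a, σ A a), ?_⟩
    intro A A' B _ _ _ a a' b h
    rw [Language.BoundedFormula.realize_imp, Language.BoundedFormula.realize_imp,
      hτ A A' B a a' b (congrArg Prod.fst h), hσ A A' B a a' b (congrArg Prod.snd h)]
  | @all n φ ih =>
    obtain ⟨T, _, τ, hτ⟩ := ih
    -- The type of a tuple is the set of types of its one-element extensions, so the number of types
    -- stays finite.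
    refine ⟨Set T, inferInstance, fun A _ a => Set.range fun x => τ A (Fin.snoc a x), ?_⟩
    have key : ∀ (A A' B : Type) [Group A] [Group A'] [Group B] (a : Fin n → A) (a' : Fin n → A')
        (b : Fin n → B), (Set.range fun x => τ A (Fin.snoc a x)) =
          (Set.range fun x => τ A' (Fin.snoc a' x)) →
        φ.all.Realize (default : Empty → A × B) (fun i => (a i, b i)) →
        φ.all.Realize (default : Empty → A' × B) (fun i => (a' i, b i)) := by
      intro A A' B _ _ _ a a' b h H
      rw [Language.BoundedFormula.realize_all] at H ⊢
      rintro ⟨x', y⟩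
      -- A back-and-forth move: replace `x'` by some `x` of the same type and leave `y` alone.
      obtain ⟨x, hx⟩ : τ A' (Fin.snoc a' x') ∈ Set.range fun x => τ A (Fin.snoc a x) :=
        h ▸ Set.mem_range_self x'
      have snoc_prod : ∀ (C : Type) (c : Fin n → C) (z : C),
          (Fin.snoc (fun i => (c i, b i)) (z, y) : Fin (n + 1) → C × B) =
            fun i => ((Fin.snoc c z : Fin (n + 1) → C) i, (Fin.snoc b y : Fin (n + 1) → B) i) := by
        intro C c z
        funext i
        refine Fin.lastCases ?_ (fun i => ?_) i <;> simp
      have := H (x, y)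
      rw [snoc_prod] at this ⊢
      exact (hτ A A' B _ _ _ hx).1 this
    intro A A' B _ _ _ a a' b h
    exact ⟨key A A' B a a' b h, key A' A B a' a b h.symm⟩

/-- In an infinite family of groups, two members are interchangeable as a direct factor as far as
a given sentence is concerned. -/
theorem exists_ne_realize_prod_iff {ι : Type*} [Infinite ι] (M : ι → Type) [∀ i, Group (M i)]
    (θ : groupLang.Sentence) :
    ∃ i j, i ≠ j ∧ ∀ (B : Type) [Group B], (M i × B) ⊨ θ ↔ (M j × B) ⊨ θ := by
  obtain ⟨T, _, τ, hτ⟩ := exists_finite_type_classification θ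
  obtain ⟨i, j, hij, h⟩ := Finite.exists_ne_map_eq_of_infinite fun i => τ (M i) default
  refine ⟨i, j, hij, fun B _ => ?_⟩
  have := hτ (M i) (M j) B _ _ default h
  unfold Language.Sentence.Realize Language.Formula.Realize
  convert this using 2

end FefermanVaught

/-! ### Powers and product decompositions in Heisenberg groups. -/

section Heisenberg

variable {R S : Type*} [CommRing R] [CommRing S]

/-- The unitriangular matrix with superdiagonal entries `x`, `y` and corner entry `z`. -/
def heis (x y z : R) : UT3 R :=
  ⟨⟨!![1, x, z; 0, 1, y; 0, 0, 1], by simp [Matrix.det_fin_three]⟩, by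
    refine ⟨fun i => ?_, fun i j h => ?_⟩
    · fin_cases i <;> rfl
    · fin_cases i <;> fin_cases j <;> first | exact absurd h (by decide) | rfl⟩

theorem heis_eq (A : UT3 R) : heis (A.1 0 1) (A.1 1 2) (A.1 0 2) = A := by
  obtain ⟨A, h, h'⟩ := A
  ext i j
  fin_cases i <;> fin_cases j <;>
    first
    | rfl
    | exact (h _).symm
    | exact (h' _ _ (by decide)).symm

theorem heis_mul (x y z x' y' z' : R) :
    heis x y z * heis x' y' z' = heis (x + x') (y + y') (z + z' + x * y') := by
  ext i j
  change (!![1, x, z; 0, 1, y; 0, 0, 1] * !![1, x', z'; 0, 1, y'; 0, 0, 1] :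
    Matrix (Fin 3) (Fin 3) R) i j =
      !![1, x + x', z + z' + x * y'; 0, 1, y + y'; 0, 0, 1] i j
  fin_cases i <;> fin_cases j <;> simp [Matrix.mul_apply, Fin.sum_univ_three] <;> ring

theorem heis_zero : (heis 0 0 0 : UT3 R) = 1 := by
  ext i j
  fin_cases i <;> fin_cases j <;> rfl

/-- Each of the `n.choose 2` pairs of factors contributes one product `x * y` to the corner. -/
theorem heis_pow (x y z : R) (n : ℕ) :
    heis x y z ^ n = heis (n * x) (n * y) (n * z + n.choose 2 * (x * y)) := by
  induction n with
  | zero => simp [heis_zero]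
  | succ n ih =>
    rw [pow_succ, ih, heis_mul, Nat.choose_succ_succ' n 1]
    congr 1 <;> push_cast [Nat.choose_one_right] <;> ring

theorem pow_surjective_of_isUnit {n : ℕ} (hn : IsUnit (n : R)) :
    Function.Surjective fun A : UT3 R => A ^ n := by
  obtain ⟨u, hu⟩ := hn.exists_right_inv
  intro A
  -- Divide the superdiagonal by `n`; the corner is first corrected by the binomial term this root
  -- produces, then divided.
  refine ⟨heis (u * A.1 0 1) (u * A.1 1 2)
    (u * (A.1 0 2 - n.choose 2 * (u * A.1 0 1 * (u * A.1 1 2)))), ?_⟩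
  dsimp only
  rw [heis_pow]
  conv_rhs => rw [← heis_eq A]
  simp only [← mul_assoc, hu, one_mul, sub_add_cancel]

/-- The upper left superdiagonal entry is additive, so in an `n`-th root of `heis 1 0 0` it is an
inverse of `n`. -/
theorem isUnit_of_pow_surjective {n : ℕ}
    (h : Function.Surjective fun A : UT3 R => A ^ n) : IsUnit (n : R) := by
  obtain ⟨A, hA⟩ := h (heis 1 0 0)
  dsimp only at hA
  rw [← heis_eq A, heis_pow] at hA
  exact IsUnit.of_mul_eq_one (A.1 0 1) (congrArg (fun B : UT3 R => B.1 0 1) hA)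

/-- The homomorphism of Heisenberg groups induced by a ring homomorphism. -/
def mapUT3 (f : R →+* S) : UT3 R →* UT3 S :=
  ((Matrix.SpecialLinearGroup.map f).comp (UT3 R).subtype).codRestrict (UT3 S) fun A =>
    ⟨fun i => (congrArg f (A.2.1 i)).trans f.map_one,
      fun i j h => (congrArg f (A.2.2 i j h)).trans f.map_zero⟩

theorem mapUT3_heis (f : R →+* S) (x y z : R) :
    mapUT3 f (heis x y z) = heis (f x) (f y) (f z) :=
  (heis_eq (mapUT3 f (heis x y z))).symm

theorem heis_inj {x y z x' y' z' : R} :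
    heis x y z = heis x' y' z' ↔ x = x' ∧ y = y' ∧ z = z' :=
  ⟨fun h => ⟨congrArg (fun B : UT3 R => B.1 0 1) h, congrArg (fun B : UT3 R => B.1 1 2) h,
    congrArg (fun B : UT3 R => B.1 0 2) h⟩, by rintro ⟨rfl, rfl, rfl⟩; rfl⟩

/-- The Heisenberg group over a product of two rings is the product of the Heisenberg groups. -/
noncomputable def equivUT3Prod {T : Type*} [CommRing T] (e : T ≃+* R × S) :
    UT3 T ≃* UT3 R × UT3 S :=
  MulEquiv.ofBijective
    ((mapUT3 ((RingHom.fst R S).comp e.toRingHom)).prod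
      (mapUT3 ((RingHom.snd R S).comp e.toRingHom))) <| by
    constructor
    · intro A B h
      rw [← heis_eq A, ← heis_eq B] at h ⊢
      simp only [MonoidHom.prod_apply, mapUT3_heis, Prod.mk.injEq, heis_inj] at h
      obtain ⟨⟨h₁, h₂, h₃⟩, h₄, h₅, h₆⟩ := h
      exact heis_inj.2 ⟨e.injective (Prod.ext h₁ h₄), e.injective (Prod.ext h₂ h₅),
        e.injective (Prod.ext h₃ h₆)⟩
    · rintro ⟨A, B⟩
      refine ⟨heis (e.symm (A.1 0 1, B.1 0 1)) (e.symm (A.1 1 2, B.1 1 2))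
        (e.symm (A.1 0 2, B.1 0 2)), ?_⟩
      conv_rhs => rw [← heis_eq A, ← heis_eq B]
      simp [mapUT3_heis]

instance secondCountable_UT3 [TopologicalSpace R] [SecondCountableTopology R] :
    SecondCountableTopology (UT3 R) :=
  haveI : SecondCountableTopology (Matrix (Fin 3) (Fin 3) R) :=
    inferInstanceAs (SecondCountableTopology (Fin 3 → Fin 3 → R))
  haveI : SecondCountableTopology (Matrix.SpecialLinearGroup (Fin 3) R) :=
    Topology.IsEmbedding.subtypeVal.secondCountableTopology
  Topology.IsEmbedding.subtypeVal.secondCountableTopology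

end Heisenberg

/-! ### Exchanging a p-adic factor. -/

theorem isUnit_natCast_padicInt {p q : ℕ} [Fact p.Prime] [Fact q.Prime] (h : p ≠ q) :
    IsUnit (q : ℤ_[p]) := by
  rw [PadicInt.isUnit_iff, PadicInt.norm_natCast_eq_one_iff]
  exact (Nat.coprime_primes Fact.out Fact.out).2 h

/-- Splitting off one factor of `∏_{p ∈ π} ℤ_p`. -/
noncomputable def padicProdSplit (π : Set Nat.Primes) (q : π) :
    PadicProd π ≃+* ℤ_[((q : Nat.Primes) : ℕ)] × PadicProd (π \ {(q : Nat.Primes)}) :=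
  RingEquiv.ofBijective
    ((Pi.evalRingHom (fun p : π => ℤ_[((p : Nat.Primes) : ℕ)]) q).prod
      (RingHom.pi fun p : (π \ {(q : Nat.Primes)} : Set Nat.Primes) =>
        Pi.evalRingHom (fun p : π => ℤ_[((p : Nat.Primes) : ℕ)]) ⟨p, p.2.1⟩)) <| by
    classical
    constructor
    · intro x y h
      funext p
      by_cases hp : p = q
      · subst hp
        exact congrArg Prod.fst h
      · exact congrFun (congrArg Prod.snd h) ⟨p, p.2, fun h => hp (Subtype.ext h)⟩
    · rintro ⟨a, b⟩
      refine ⟨fun p => if h : p = q then h ▸ a else b ⟨p, p.2, fun h' => h (Subtype.ext h')⟩, ?_⟩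
      refine Prod.ext (by simp) (funext fun p => ?_)
      have : (⟨p, p.2.1⟩ : π) ≠ q := fun h => p.2.2 (congrArg Subtype.val h)
      exact dif_neg this

theorem finite_of_isFAWithin_separable (π : Set Nat.Primes)
    (h : IsFAWithin separableProfinite (profiniteUT3 (PadicProd π))) : π.Finite := by
  obtain ⟨θ, hG, hθ⟩ := h
  by_contra hπ
  have : Infinite π := Set.infinite_coe_iff.2 hπ
  obtain ⟨q, q', hne, hq⟩ :=
    exists_ne_realize_prod_iff (fun p : π => UT3 ℤ_[((p : Nat.Primes) : ℕ)]) θ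
  have hval : ∀ p : Nat.Primes, p ≠ q → (p : ℕ) ≠ ((q : Nat.Primes) : ℕ) :=
    fun p hp h => hp (Subtype.ext h)
  have hH := (hq _).1 ((realize_sentence_iff_of_mulEquiv
    (equivUT3Prod (padicProdSplit π q)) θ).1 hG)
  obtain ⟨e⟩ := hθ (ProfiniteGrp.of (UT3 ℤ_[((q' : Nat.Primes) : ℕ)] ×
    UT3 (PadicProd (π \ {(q : Nat.Primes)}))))
    (inferInstanceAs (SecondCountableTopology (UT3 ℤ_[((q' : Nat.Primes) : ℕ)] ×
      UT3 (PadicProd (π \ {(q : Nat.Primes)}))))) hH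
  -- In the modified group `q` is invertible in every coordinate ring, so `q`-th roots exist there;
  -- `e` carries them over.
  have hsurj : Function.Surjective fun A : UT3 (PadicProd π) => A ^ ((q : Nat.Primes) : ℕ) := by
    intro A
    obtain ⟨⟨B, C⟩, hBC⟩ := e.surjective A
    obtain ⟨B', hB'⟩ := pow_surjective_of_isUnit (n := ((q : Nat.Primes) : ℕ))
      (isUnit_natCast_padicInt (hval q' fun h => hne (Subtype.ext h.symm))) B
    obtain ⟨C', hC'⟩ := pow_surjective_of_isUnit (R := PadicProd (π \ {(q : Nat.Primes)}))
      (n := ((q : Nat.Primes) : ℕ)) (Pi.isUnit_iff.2 fun p =>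
        isUnit_natCast_padicInt (hval p p.2.2)) C
    have hpow : ((B', C') : UT3 ℤ_[((q' : Nat.Primes) : ℕ)] ×
        UT3 (PadicProd (π \ {(q : Nat.Primes)}))) ^ ((q : Nat.Primes) : ℕ) = (B, C) :=
      Prod.ext hB' hC'
    exact ⟨e (B', C'), (map_pow e _ _).symm.trans ((congrArg e hpow).trans hBC)⟩
  have hunit : IsUnit (((q : Nat.Primes) : ℕ) : ℤ_[((q : Nat.Primes) : ℕ)]) := by
    have := (isUnit_of_pow_surjective hsurj).map
      (Pi.evalRingHom (fun p : π => ℤ_[((p : Nat.Primes) : ℕ)]) q)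
    rwa [map_natCast] at this
  exact PadicInt.prime_p.not_isUnit hunit

theorem IsFAWithin.mono {𝒞 𝒟 : Set ProfiniteGrp.{0}} {G : ProfiniteGrp.{0}} (h : 𝒟 ⊆ 𝒞) :
    IsFAWithin 𝒞 G → IsFAWithin 𝒟 G :=
  fun ⟨θ, hG, hθ⟩ => ⟨θ, hG, fun H hH => hθ H (h hH)⟩

end HeisenbergFA

theorem mainTheorem11 (π : Set Nat.Primes) :
    (HeisenbergFA.IsFAWithin HeisenbergFA.allProfinite
        (HeisenbergFA.profiniteUT3 (HeisenbergFA.PadicProd π)) → π.Finite) ∧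
    (HeisenbergFA.IsFAWithin HeisenbergFA.separableProfinite
        (HeisenbergFA.profiniteUT3 (HeisenbergFA.PadicProd π)) → π.Finite) :=
  ⟨fun h => HeisenbergFA.finite_of_isFAWithin_separable π (h.mono (Set.subset_univ _)),
    HeisenbergFA.finite_of_isFAWithin_separable π⟩
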